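/- **Setting.** Let $L$ be a finite field, $\sigma,\tau$ automorphisms of $L$, $\overline\tau=\tau^{-1}$, $K$ the fixed field of $\sigma$, and $N_{L:K}$ the norm. For $\alpha,\eta\in L$ let $\mathcal S_{\sigma,\tau,\alpha,\eta}$ be $L^2$ with the multiplication $$\begin{pmatrix}x_0\\x_1\end{pmatrix}\circ\begin{pmatrix}y_0\\y_1\end{pmatrix}=\begin{pmatrix}x_1y_1^{\sigma}-\eta x_1^{\sigma}y_1+\alpha\bigl(x_0y_0^{\sigma}-\eta^{\overline\tau}x_0^{\sigma}y_0\bigr)\\ x_0^{\tau}y_1+x_1y_0^{\tau}\end{pmatrix}.$$ Call $\alpha$ *admissible* if $\alpha\neq0$ and $\alpha\notin\{x^{\sigma+1}y^{\tau-1}: x,y\in L^*\}$ (where $x^{\sigma+1}=x^\sigma x$, $y^{\tau-1}=y^\tau/y$), and call $(\alpha,\eta)$ *admissible* if $\alpha$ is admissible and $N_{L:K}(\eta)\neq1$. A *Zhou–Pott semifield* is $F^2$, for a finite field $F$ of odd characteristic, with the multiplication $$\begin{pmatrix}x_0\\x_1\end{pmatrix}\circ_{ZP}\begin{pmatrix}y_0\\y_1\end{pmatrix}=\begin{pmatrix}x_0^{\sigma'}y_0+x_0y_0^{\sigma'}+\alpha'(x_1^{\sigma'}y_1+x_1y_1^{\sigma'})^{\tau'}\\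 x_0y_1+x_1y_0\end{pmatrix},$$ where $\sigma',\tau'$ are automorphisms of $F$, $\sigma'$ has odd order and $\alpha'\in F$ is a non-square. A *(pre-)semifield* is a group $(S,+)$ with a multiplication that is distributive on both sides and has no zero divisors. Two (pre-)semifields are *isotopic* if there are additive bijections $N_1,N_2,N_3$ with $N_1(x\circ_1y)=N_2(x)\circ_2N_3(y)$ for all $x,y$. **Statement.** 1. If $(\alpha,\eta)$ is admissible, then $\mathcal S_{\sigma,\tau,\alpha,\eta}$ is a (pre-)semifield. 2. Let $\sigma^2\neq\mathrm{id}$, $\tau\neq\mathrm{id}$ and let $(\alpha,\eta)$ be admissible. Then $\mathcal S_{\sigma,\tau,\alpha,\eta}$ is isotopic to a Zhou–Pott semifield if and only if $\sigma$ has odd order and $N_{L:K}(\eta)=-1$. 3. Every Zhou–Pott semifield is isotopic to a member of the new family: if $L$ has odd characteristic, $\sigma$ has odd order and $\alpha$ is a non-square, then $(\alpha,-1)$ is admissible for $(\sigma,\overline\tau)$, and the Zhou–Pott semifield with parameters $\sigma,\tau,\alpha$ is isotopic to $\mathcal S_{\sigma,\overline\tau,\alpha,-1}$. 4. The extension is proper: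 if $L$ has odd characteristic, $\sigma^2\ne\mathrm{id}$, $\tau\neq\mathrm{id}$, and $|K|>3$ or $\sigma$ has even order, then there is an admissible pair $(\alpha,\eta)$ with $\eta\neq0$ for which $\mathcal S_{\sigma,\tau,\alpha,\eta}$ is not isotopic to any Zhou–Pott semifield. 5. The extension is vast: if $L$ has odd characteristic, $\sigma^2\ne\mathrm{id}$, $\tau\neq\mathrm{id}$, $\sigma$ has odd order and $\alpha$ is admissible, then the number of $\eta\in L^*$ with $(\alpha,\eta)$ admissible is exactly $|K|-2$ times the number of those among them for which $\mathcal S_{\sigma,\tau,\alpha,\eta}$ is isotopic to a Zhou–Pott semifield. -/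

import Mathlib

universe u

/-- A multiplication on an additive group is that of a pre-semifield: both distributive laws hold
and there are no zero divisors. -/
structure IsPresemifield {S : Type*} [AddGroup S] (mul : S → S → S) : Prop where
  left_distrib : ∀ x y z, mul x (y + z) = mul x y + mul x z
  right_distrib : ∀ x y z, mul (x + y) z = mul x z + mul y z
  eq_zero_or_eq_zero : ∀ x y, mul x y = 0 → x = 0 ∨ y = 0

/-- Isotopy of two multiplications. On elementary abelian `p`-groups the additive bijections are
exactly the `𝔽_p`-linear ones. -/
def Isotopic {S T : Type*} [AddGroup S] [AddGroup T] (f : S → S → S) (g : T → T → T) : Prop :=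
  ∃ N₁ N₂ N₃ : S ≃+ T, ∀ x y, N₁ (f x y) = g (N₂ x) (N₃ y)

/-- The fixed field of an automorphism of a field. -/
def fixedSubfield {L : Type*} [Field L] (σ : RingAut L) : Subfield L :=
  RingHom.eqLocusField (σ : L →+* L) (RingHom.id L)

/-- The relative norm from `L` to the fixed field of `σ`. -/
noncomputable def fixedNorm {L : Type*} [Field L] (σ : RingAut L) (η : L) : fixedSubfield σ :=
  Algebra.norm (fixedSubfield σ) η

/-- The Zhou–Pott multiplication on `L²`. -/
def zhouPottMul {L : Type*} [Field L] (σ τ : RingAut L) (α : L) (x y : L × L) : L × L :=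
  (σ x.1 * y.1 + x.1 * σ y.1 + α * τ (σ x.2 * y.2 + x.2 * σ y.2),
    x.1 * y.2 + x.2 * y.1)

/-- The conditions on the parameters of a Zhou–Pott semifield: odd characteristic, `σ` of odd
order, `α` a non-square. -/
structure IsZhouPottParam {L : Type*} [Field L] (σ : RingAut L) (α : L) : Prop where
  char_ne_two : ringChar L ≠ 2
  odd_order : Odd (orderOf σ)
  not_isSquare : ¬ IsSquare α

/-- `f` is isotopic to a member of the Zhou–Pott family, over any finite field `F`. -/
def IsIsotopicToZhouPott {S : Type u} [AddGroup S] (f : S → S → S) : Prop :=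
  ∃ (F : Type u) (_ : Field F) (_ : Finite F) (σ τ : RingAut F) (α : F),
    IsZhouPottParam σ α ∧ Isotopic f (zhouPottMul σ τ α)

/-- The multiplication of the family `𝒮_{σ,τ,α,η}` on `L²`. -/
def familyMul {L : Type*} [Field L] (σ τ : RingAut L) (α η : L) (x y : L × L) : L × L :=
  (x.2 * σ y.2 - η * σ x.2 * y.2 + α * (x.1 * σ y.1 - τ⁻¹ η * σ x.1 * y.1),
    τ x.1 * y.2 + x.2 * τ y.1)

/-- The condition on `α`: it is nonzero and not of the form `x^(σ+1) * y^(τ-1)`. -/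
structure IsFamilyAlpha {L : Type*} [Field L] (σ τ : RingAut L) (α : L) : Prop where
  ne_zero : α ≠ 0
  ne_mul : ∀ x y : L, x ≠ 0 → y ≠ 0 → α ≠ (σ x * x) * (τ y / y)

/-- The conditions on the parameters of the family `𝒮_{σ,τ,α,η}`. -/
structure IsFamilyParam {L : Type*} [Field L] (σ τ : RingAut L) (α η : L) : Prop where
  alpha : IsFamilyAlpha σ τ α
  norm_ne_one : fixedNorm σ η ≠ 1

/-! Write N for the norm from L to K. A zero product with nonzero first coordinates has its second
coordinates related by one u, and its first component reads α = u^(σ+1) z^(τ-1) for some z ≠ 0,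
which admissibility of α forbids. That z ≠ 0 comes from N(η) ≠ 1.

Zhou–Pott semifields are commutative, so an isotopy to one yields an additive bijection A with A x ∘
y = A y ∘ x. The second component determines A up to three constants B, C, D. The first then gives
-η σ(τ D) = τ D, while D = 0 is excluded by independence of characters. Hence N(-η) = 1, which
together with N(η) ≠ 1 forces odd order and N(η) = -1. Conversely, Hilbert 90 solves -η b = σ b;
scaling by b brings η to -1, and exchanging coordinates gives a Zhou–Pott semifield. The counts in
the last two claims follow because N is surjective with equal fibres over nonzero values. -/

/-! ### Norms and Hilbert 90 over the fixed field of an automorphism -/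

section FixedField

variable {L : Type*} [Field L] (σ : RingAut L)

/-- An automorphism, as an algebra automorphism over its own fixed field. -/
def fixedAut : L ≃ₐ[fixedSubfield σ] L :=
  AlgEquiv.ofRingEquiv (f := σ) fun x => x.2

@[simp]
theorem fixedAut_apply (x : L) : fixedAut σ x = σ x := rfl

theorem fixedAut_pow_apply (n : ℕ) (x : L) : (fixedAut σ ^ n) x = (σ ^ n) x := by
  induction n generalizing x with
  | zero => rfl
  | succ n ih => rw [pow_succ, pow_succ, AlgEquiv.mul_apply, RingAut.mul_apply, ih, fixedAut_apply]

theorem orderOf_fixedAut : orderOf (fixedAut σ) = orderOf σ := by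
  rw [orderOf_eq_orderOf_iff]
  intro n
  constructor <;> intro h <;> ext x
  · rw [← fixedAut_pow_apply, h]; rfl
  · rw [fixedAut_pow_apply, h]; rfl

/-- Galois correspondence: an element fixed by the subgroup that σ generates is fixed by σ, hence
lies in the base field. -/
theorem zpowers_fixedAut [Finite L] : Subgroup.zpowers (fixedAut σ) = ⊤ := by
  rw [← IntermediateField.fixingSubgroup_fixedField (Subgroup.zpowers (fixedAut σ)),
    show IntermediateField.fixedField (Subgroup.zpowers (fixedAut σ)) = ⊥ from ?_,
    IntermediateField.fixingSubgroup_bot]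
  rw [eq_bot_iff]
  intro x hx
  have h : σ x = x := hx ⟨fixedAut σ, Subgroup.mem_zpowers _⟩
  exact IntermediateField.mem_bot.2 ⟨⟨x, h⟩, rfl⟩

theorem finrank_fixedSubfield [Finite L] : Module.finrank (fixedSubfield σ) L = orderOf σ := by
  rw [← IsGalois.card_aut_eq_finrank, ← orderOf_fixedAut, ← Nat.card_zpowers, zpowers_fixedAut,
    Subgroup.card_top]

@[simp]
theorem fixedNorm_mul (x y : L) : fixedNorm σ (x * y) = fixedNorm σ x * fixedNorm σ y :=
  map_mul _ x y

@[simp]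
theorem fixedNorm_apply_self (x : L) : fixedNorm σ (σ x) = fixedNorm σ x :=
  Algebra.norm_eq_of_algEquiv (fixedAut σ) x

theorem fixedNorm_neg_one [Finite L] : fixedNorm σ (-1) = (-1) ^ orderOf σ := by
  have h := Algebra.norm_algebraMap (S := L) (-1 : fixedSubfield σ)
  rw [finrank_fixedSubfield, map_neg, map_one] at h
  exact h

theorem fixedNorm_neg [Finite L] (x : L) : fixedNorm σ (-x) = (-1) ^ orderOf σ * fixedNorm σ x := by
  rw [← neg_one_mul, fixedNorm_mul, fixedNorm_neg_one]

theorem fixedNorm_ne_zero [Finite L] {x : L} : fixedNorm σ x ≠ 0 ↔ x ≠ 0 :=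
  Algebra.norm_ne_zero_iff

theorem fixedNorm_surjective [Finite L] : Function.Surjective (fixedNorm σ) :=
  FiniteField.norm_surjective (fixedSubfield σ) L

/-- A factor `c` relating `a` to its image under `σ` has norm one. -/
theorem fixedNorm_eq_one_of_mul_eq [Finite L] {a c : L} (ha : a ≠ 0) (h : c * σ a = a) :
    fixedNorm σ c = 1 := by
  have h' := congrArg (fixedNorm σ) h
  rw [fixedNorm_mul, fixedNorm_apply_self] at h'
  exact mul_right_cancel₀ ((fixedNorm_ne_zero σ).2 ha) (h'.trans (one_mul _).symm)

/-- Hilbert's Theorem 90 for the fixed field of an automorphism of a finite field. -/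
theorem exists_mul_eq_of_fixedNorm_eq_one [Finite L] {c : L} (h : fixedNorm σ c = 1) :
    ∃ b, b ≠ 0 ∧ c * b = σ b := by
  let N : Lˣ →* (fixedSubfield σ)ˣ := Units.map (Algebra.norm (fixedSubfield σ))
  let φ : Lˣ →* Lˣ := Units.map (σ : L →* L) / MonoidHom.id Lˣ
  have hφ (b : Lˣ) : (φ b : L) = σ b / b := by simp [φ, div_eq_mul_inv]
  have hN : Function.Surjective N := FiniteField.unitsMap_norm_surjective _ L
  let ι : (fixedSubfield σ)ˣ →* Lˣ := Units.map (algebraMap (fixedSubfield σ) L)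
  have hι : Function.Injective ι := Units.map_injective Subtype.val_injective
  have hker : φ.ker = ι.range := by
    ext b
    rw [MonoidHom.mem_ker, Units.ext_iff, hφ, Units.val_one, div_eq_one_iff_eq b.ne_zero]
    constructor
    · intro hb
      refine ⟨Units.mk0 ⟨b, hb⟩ fun h0 => b.ne_zero (congrArg Subtype.val h0), ?_⟩
      ext; rfl
    · rintro ⟨k, rfl⟩
      exact (k : fixedSubfield σ).2
  have hle : φ.range ≤ N.ker := by
    rintro _ ⟨b, rfl⟩
    rw [MonoidHom.mem_ker, Units.ext_iff]
    refine fixedNorm_eq_one_of_mul_eq σ (a := (b : L)⁻¹) (by simp) ?_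
    have := b.ne_zero
    have h2 : σ b ≠ 0 := by simp
    rw [hφ, map_inv₀]
    field_simp
  -- The image of b ↦ σ b / b lies in the kernel of the norm; both have order |L*| / |K*|, the norm
  -- being surjective.
  have hcard : Nat.card φ.range = Nat.card N.ker := by
    have e1 : Nat.card φ.ker * Nat.card φ.range = Nat.card Lˣ := by
      rw [← Subgroup.index_ker, Subgroup.card_mul_index]
    have e2 : Nat.card N.ker * Nat.card (fixedSubfield σ)ˣ = Nat.card Lˣ := by
      have h1 := Subgroup.index_ker N
      rw [MonoidHom.range_eq_top.2 hN, Subgroup.card_top] at h1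
      rw [← h1, Subgroup.card_mul_index]
    have e3 : Nat.card φ.ker = Nat.card (fixedSubfield σ)ˣ := by
      rw [hker]
      exact (Nat.card_congr (MonoidHom.ofInjective hι).toEquiv).symm
    rw [← e2, e3, mul_comm] at e1
    exact Nat.eq_of_mul_eq_mul_right Nat.card_pos e1
  have hc : c ≠ 0 := by
    rw [← fixedNorm_ne_zero σ, h]
    exact one_ne_zero
  have hmem : Units.mk0 c hc ∈ N.ker := by
    rw [MonoidHom.mem_ker, Units.ext_iff]
    exact h
  rw [← Subgroup.eq_of_le_of_card_ge hle hcard.ge] at hmem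
  obtain ⟨b, hb⟩ := hmem
  have := congrArg Units.val hb
  rw [hφ, Units.val_mk0, div_eq_iff b.ne_zero] at this
  exact ⟨b, b.ne_zero, this.symm⟩

/-- The automorphisms of a finite field commute. -/
theorem ringAut_comm [Finite L] (σ τ : RingAut L) (x : L) : σ (τ x) = τ (σ x) := by
  have : Fintype L := Fintype.ofFinite L
  obtain ⟨p, hp⟩ := CharP.exists L
  have : Fact p.Prime := ⟨CharP.char_is_prime L p⟩
  let _ : Algebra (ZMod p) L := ZMod.algebra L p
  let lift (ρ : RingAut L) : Gal(L/ZMod p) :=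
    AlgEquiv.ofRingEquiv (f := ρ) fun k => RingHom.congr_fun
      (RingHom.ext_zmod ((ρ : L →+* L).comp (algebraMap (ZMod p) L)) (algebraMap (ZMod p) L)) k
  -- The Galois group over the prime field is cyclic.
  let _ : CommGroup Gal(L/ZMod p) := IsCyclic.commGroup
  exact DFunLike.congr_fun (mul_comm (lift σ) (lift τ)) x

end FixedField

/-! ### Squares and automorphisms -/

section Squares

variable {L : Type*} [Field L]

theorem ringChar_ne_two_iff : ringChar L ≠ 2 ↔ (-1 : L) ≠ 1 := by
  constructor
  · exact Ring.neg_one_ne_one_of_char_ne_two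
  · intro h h2
    have := ringChar.of_eq h2
    exact h (CharTwo.neg_eq (1 : L))

theorem isSquare_apply_iff (σ : RingAut L) {x : L} : IsSquare (σ x) ↔ IsSquare x := by
  constructor
  · intro h
    simpa using h.map σ.symm
  · exact fun h => h.map σ

/-- An automorphism preserves the quadratic character, so the characters of the two factors cancel.
-/
theorem isSquare_apply_mul_self [Finite L] (σ : RingAut L) (x : L) : IsSquare (σ x * x) := by
  by_cases h : IsSquare x
  · exact ((isSquare_apply_iff σ).2 h).mul h
  · have : Fintype L := Fintype.ofFinite L
    classical
    have h0 : x ≠ 0 := fun h0 => h (h0 ▸ IsSquare.zero)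
    have h1 : quadraticChar L x = -1 := quadraticChar_neg_one_iff_not_isSquare.2 h
    have h2 : quadraticChar L (σ x) = -1 :=
      quadraticChar_neg_one_iff_not_isSquare.2 fun h' => h ((isSquare_apply_iff σ).1 h')
    refine (quadraticChar_one_iff_isSquare (by simp [h0])).1 ?_
    rw [map_mul, h1, h2]; rfl

theorem isSquare_apply_div_self [Finite L] (σ : RingAut L) (x : L) : IsSquare (σ x / x) := by
  by_cases h0 : x = 0
  · simp [h0]
  · have := (isSquare_apply_mul_self σ x).div (IsSquare.mul_self x)
    rwa [mul_div_mul_right _ _ h0] at this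

/-- If `σ` has odd order then every square is of the form `x ^ (σ + 1)`. -/
theorem exists_apply_mul_self_eq_sq {σ : RingAut L} (h : Odd (orderOf σ)) {b : L} (hb : b ≠ 0) :
    ∃ x, x ≠ 0 ∧ σ x * x = b * b := by
  -- Telescoping: the factor σ c / c contributes σ² c / c, raising the exponent of σ by two. At
  -- exponent `orderOf σ` the right side is b².
  have key : ∀ n : ℕ, ∃ x, x ≠ 0 ∧ σ x * x = b * (σ ^ (2 * n + 1)) b := by
    intro n
    induction n with
    | zero => exact ⟨b, hb, by simp [mul_comm]⟩
    | succ n ih =>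
      obtain ⟨x, hx, hxe⟩ := ih
      have hc : (σ ^ (2 * n + 1)) b ≠ 0 := (map_ne_zero_iff _ (RingEquiv.injective _)).2 hb
      have hc' : σ ((σ ^ (2 * n + 1)) b) ≠ 0 := (map_ne_zero_iff _ (RingEquiv.injective _)).2 hc
      have e2 : (σ ^ (2 * (n + 1) + 1)) b = σ (σ ((σ ^ (2 * n + 1)) b)) := by
        rw [show 2 * (n + 1) + 1 = (2 * n + 1) + 1 + 1 by ring, pow_succ', pow_succ']; rfl
      refine ⟨x * (σ ((σ ^ (2 * n + 1)) b) / (σ ^ (2 * n + 1)) b),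
        mul_ne_zero hx (div_ne_zero hc' hc), ?_⟩
      rw [e2, map_mul, map_div₀]
      field_simp
      linear_combination σ (σ ((σ ^ (2 * n + 1)) b)) * hxe
  obtain ⟨n, hn⟩ := h
  obtain ⟨x, hx, hxe⟩ := key n
  rw [← hn, pow_orderOf_eq_one] at hxe
  exact ⟨x, hx, hxe⟩

end Squares

/-! ### Isotopy and commutativity -/

section Isotopy

variable {S T U : Type*} [AddGroup S] [AddGroup T] [AddGroup U]

theorem Isotopic.symm {f : S → S → S} {g : T → T → T} (h : Isotopic f g) : Isotopic g f := by
  obtain ⟨N₁, N₂, N₃, h⟩ := h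
  exact ⟨N₁.symm, N₂.symm, N₃.symm, fun x y => by simp [N₁.symm_apply_eq, h]⟩

theorem Isotopic.trans {f : S → S → S} {g : T → T → T} {k : U → U → U} (h : Isotopic f g)
    (h' : Isotopic g k) : Isotopic f k := by
  obtain ⟨N₁, N₂, N₃, h⟩ := h
  obtain ⟨M₁, M₂, M₃, h'⟩ := h'
  exact ⟨N₁.trans M₁, N₂.trans M₂, N₃.trans M₃, fun x y => by simp [h, h']⟩

/-- A multiplication that is isotopic to a commutative one becomes commutative when its left
argument is twisted by a suitable additive bijection. -/
theorem Isotopic.exists_twist_comm {f : S → S → S} {g : T → T → T} (h : Isotopic f g)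
    (hg : ∀ x y, g x y = g y x) : ∃ A : S ≃+ S, ∀ x y, f (A x) y = f (A y) x := by
  obtain ⟨N₁, N₂, N₃, h⟩ := h
  refine ⟨N₃.trans N₂.symm, fun x y => N₁.injective ?_⟩
  simp [h, hg (N₃ x)]

end Isotopy

/-! ### The family and its Zhou–Pott members -/

section Family

variable {L : Type*} [Field L] {σ τ : RingAut L} {α η : L}

theorem zhouPottMul_comm (σ τ : RingAut L) (α : L) (x y : L × L) :
    zhouPottMul σ τ α x y = zhouPottMul σ τ α y x := by
  simp only [zhouPottMul, Prod.mk.injEq]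
  constructor
  · rw [add_comm (σ x.1 * y.1), mul_comm x.1, mul_comm (σ x.1), add_comm (σ x.2 * y.2),
      mul_comm x.2, mul_comm (σ x.2)]
  · ring

/-- Vanishing would mean η σ(x/y) = x/y, hence norm one. -/
theorem ne_zero_of_fixedNorm_ne_one [Finite L] (hη : fixedNorm σ η ≠ 1) {x y : L} (hx : x ≠ 0)
    (hy : y ≠ 0) : x * σ y - η * σ x * y ≠ 0 := by
  intro h
  refine hη (fixedNorm_eq_one_of_mul_eq σ (a := x / y) (div_ne_zero hx hy) ?_)
  have : σ y ≠ 0 := by simpa using hy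
  rw [map_div₀]
  field_simp
  linear_combination -h

theorem isPresemifield_familyMul [Finite L] (h : IsFamilyParam σ τ α η) :
    IsPresemifield (familyMul σ τ α η) where
  left_distrib x y z := by
    simp only [familyMul, Prod.fst_add, Prod.snd_add, map_add, Prod.mk_add_mk, Prod.mk.injEq]
    constructor <;> ring
  right_distrib x y z := by
    simp only [familyMul, Prod.fst_add, Prod.snd_add, map_add, Prod.mk_add_mk, Prod.mk.injEq]
    constructor <;> ring
  eq_zero_or_eq_zero := by
    rintro ⟨x₀, x₁⟩ ⟨y₀, y₁⟩ hxy
    simp only [familyMul, Prod.mk_eq_zero] at hxy ⊢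
    obtain ⟨h1, h2⟩ := hxy
    have hne {x y : L} := ne_zero_of_fixedNorm_ne_one h.norm_ne_one (x := x) (y := y)
    by_cases hx0 : x₀ = 0
    · subst hx0
      by_cases hx1 : x₁ = 0
      · exact Or.inl ⟨rfl, hx1⟩
      have hy0 : y₀ = 0 := by simpa [hx1] using h2
      subst hy0
      by_cases hy1 : y₁ = 0
      · exact Or.inr ⟨rfl, hy1⟩
      exact absurd (by simpa using h1) (hne hx1 hy1)
    have hτx : τ x₀ ≠ 0 := by simpa using hx0
    by_cases hy0 : y₀ = 0
    · subst hy0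
      exact Or.inr ⟨rfl, by simpa [hx0] using h2⟩
    have hτy : τ y₀ ≠ 0 := by simpa using hy0
    exfalso
    -- With u = y₁ / τ y₀, the vanishing second component forces x₁ = -u τ x₀.
    obtain ⟨u, rfl⟩ : ∃ u, y₁ = u * τ y₀ := ⟨y₁ / τ y₀, by field_simp⟩
    obtain rfl : x₁ = -(u * τ x₀) := by
      apply mul_right_cancel₀ hτy
      linear_combination h2
    set z := x₀ * σ y₀ - τ⁻¹ η * σ x₀ * y₀ with hz
    -- The twist τ⁻¹ η in the multiplication makes τ z the same kind of expression with η itself.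
    have hτz : τ z = τ x₀ * σ (τ y₀) - η * σ (τ x₀) * τ y₀ := by
      have : τ (τ⁻¹ η) = η := τ.apply_symm_apply η
      rw [hz, map_sub, map_mul, map_mul, map_mul, this, ringAut_comm σ τ, ringAut_comm σ τ]
    have hτz0 : τ z ≠ 0 := hτz ▸ hne hτx hτy
    have hz0 : z ≠ 0 := fun h0 => hτz0 (by rw [h0, map_zero])
    have h3 : α * z = σ u * u * τ z := by
      rw [hτz]
      simp only [map_neg, map_mul] at h1
      linear_combination h1
    have hu : u ≠ 0 := by
      rintro rfl
      exact mul_ne_zero h.alpha.ne_zero hz0 (by simpa using h3)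
    refine h.alpha.ne_mul u z hu hz0 ?_
    rw [← mul_div_assoc, eq_div_iff hz0, h3]

/-- The shape of a twist that makes the second coordinate of the multiplication symmetric. -/
theorem exists_twist_coeff {A : L × L ≃+ L × L}
    (hA : ∀ x y, familyMul σ τ α η (A x) y = familyMul σ τ α η (A y) x) :
    ∃ B C D : L, (∀ t, A (t, 0) = (D * t, C * τ t)) ∧
      ∀ t, A (0, t) = (τ⁻¹ (B * t), τ D * t) := by
  -- Second components alone suffice: pairing with (1, 0) or (0, 1) expresses A through its values
  -- at these two vectors.
  have h2 (x y : L × L) : τ (A x).1 * y.2 + (A x).2 * τ y.1 = τ (A y).1 * x.2 + (A y).2 * τ x.1 :=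
    congrArg Prod.snd (hA x y)
  have hd (t : L) : (A (0, t)).2 = τ (A (1, 0)).1 * t := by simpa using (h2 (1, 0) (0, t)).symm
  refine ⟨τ (A (0, 1)).1, (A (1, 0)).2, (A (1, 0)).1, fun t => Prod.ext ?_ ?_, fun t =>
    Prod.ext ?_ (hd t)⟩
  · apply τ.injective
    have := h2 (t, 0) (0, 1)
    rw [hd] at this
    simpa using this
  · simpa using h2 (t, 0) (1, 0)
  · apply τ.injective
    have e : τ (τ⁻¹ (τ (A (0, 1)).1 * t)) = τ (A (0, 1)).1 * t := τ.apply_symm_apply _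
    simp only [e]
    simpa using h2 (0, t) (0, 1)

/-- Linear independence of characters in two variables. -/
theorem coeff_eq_zero_of_bilinear {C E F G : L} (hσ : σ ^ 2 ≠ 1) (hτ : τ ≠ 1)
    (h : ∀ u y, C * (τ u * σ y) + E * (σ (τ u) * y) + F * (σ u * τ⁻¹ y) +
      G * (u * σ (τ⁻¹ y)) = 0) : C = 0 := by
  have hσ1 : σ ≠ 1 := by rintro rfl; exact hσ (one_pow 2)
  let χ (ρ κ : RingAut L) : L × L →* L :=
    ((ρ : L →* L).comp (MonoidHom.fst L L)) * ((κ : L →* L).comp (MonoidHom.snd L L))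
  have hχ (ρ κ : RingAut L) (u y : L) : χ ρ κ (u, y) = ρ u * κ y := rfl
  have hinj {ρ κ ρ' κ' : RingAut L} (e : χ ρ κ = χ ρ' κ') : ρ = ρ' ∧ κ = κ' := by
    constructor <;> ext t
    · simpa [hχ] using DFunLike.congr_fun e (t, 1)
    · simpa [hχ] using DFunLike.congr_fun e (1, t)
  -- These characters are distinct: f 0 = f 2 or f 1 = f 3 would give σ² = 1, f 0 = f 3 or f 1 = f 2
  -- would give τ = 1, and the other coincidences σ = 1.
  let f : Fin 4 → (L × L →* L) := ![χ τ σ, χ (σ * τ) 1, χ σ τ⁻¹, χ 1 (σ * τ⁻¹)]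
  have h01 : f 0 ≠ f 1 := fun e => hσ1 (hinj e).2
  have h02 : f 0 ≠ f 2 := fun e => hσ (by
    obtain ⟨e1, e2⟩ := hinj e
    rw [pow_two]
    nth_rw 2 [e2]
    rw [← e1, mul_inv_cancel])
  have h03 : f 0 ≠ f 3 := fun e => hτ (hinj e).1
  have h12 : f 1 ≠ f 2 := fun e => hτ (by simpa using (hinj e).1)
  have h13 : f 1 ≠ f 3 := fun e => hσ (by
    obtain ⟨e1, e2⟩ := hinj e
    rw [pow_two, ← e1]
    congr 1
    exact mul_inv_eq_one.1 e2.symm)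
  have h23 : f 2 ≠ f 3 := fun e => hσ1 (hinj e).1
  have hf : Function.Injective f := by
    intro i j hij
    fin_cases i <;> fin_cases j <;> first
      | rfl
      | exact absurd hij ‹_›
      | exact absurd hij.symm ‹_›
  have hli := (linearIndependent_monoidHom (L × L) L).comp f hf
  rw [Fintype.linearIndependent_iff] at hli
  refine hli ![C, E, F, G] ?_ 0
  ext ⟨u, y⟩
  simpa [Fin.sum_univ_four, f, hχ, add_assoc] using h u y

theorem odd_and_fixedNorm_eq_neg_one [Finite L] (hσ : σ ^ 2 ≠ 1) (hτ : τ ≠ 1)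
    (h : IsFamilyParam σ τ α η) {A : L × L ≃+ L × L}
    (hA : ∀ x y, familyMul σ τ α η (A x) y = familyMul σ τ α η (A y) x) :
    Odd (orderOf σ) ∧ fixedNorm σ η = -1 := by
  obtain ⟨B, C, D, hA0, hA1⟩ := exists_twist_coeff hA
  have h1 (x y : L × L) := congrArg Prod.fst (hA x y)
  obtain ⟨y, hy⟩ : ∃ y, σ y ≠ y := by
    by_contra! hid
    have : σ = 1 := RingEquiv.ext hid
    exact hσ (by rw [this, one_pow])
  -- Comparing (0, 1) with (0, y) leaves a factor σ y - y, nonzero by the choice of y.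
  have hD : -η * σ (τ D) = τ D := by
    have := h1 (0, 1) (0, y)
    simp only [familyMul, hA1, map_mul, map_zero, map_one] at this
    have h3 : (-η * σ (τ D) - τ D) * (σ y - y) = 0 := by linear_combination -this
    exact sub_eq_zero.1 ((mul_eq_zero.1 h3).resolve_right (sub_ne_zero.2 hy))
  -- If D = 0, the pairs (u, 0), (0, y) give a character relation with leading coefficient C; then C
  -- = 0 and A kills (1, 0).
  have hD0 : D ≠ 0 := by
    rintro rfl
    have hC : C = 0 := by
      refine coeff_eq_zero_of_bilinear (σ := σ) (τ := τ) (E := -(η * σ C)) (F := -(α * τ⁻¹ B))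
        (G := α * (τ⁻¹ η * σ (τ⁻¹ B))) hσ hτ fun u y => ?_
      have := h1 (u, 0) (0, y)
      simp only [familyMul, hA0, hA1, map_mul, map_zero] at this
      linear_combination this
    have : A (1, 0) = 0 := by rw [hA0, hC]; simp
    exact one_ne_zero (congrArg Prod.fst (A.map_eq_zero_iff.1 this))
  have hN : fixedNorm σ (-η) = 1 :=
    fixedNorm_eq_one_of_mul_eq σ (a := τ D) (by simpa using hD0) hD
  rw [fixedNorm_neg] at hN
  rcases Nat.even_or_odd (orderOf σ) with he | ho
  · rw [he.neg_one_pow, one_mul] at hN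
    exact absurd hN h.norm_ne_one
  · rw [ho.neg_one_pow, neg_one_mul] at hN
    exact ⟨ho, neg_eq_iff_eq_neg.1 hN⟩

theorem isFamilyAlpha_of_not_isSquare [Finite L] (h : ¬ IsSquare α) : IsFamilyAlpha σ τ α where
  ne_zero := by
    rintro rfl
    exact h IsSquare.zero
  ne_mul x y _ _ := by
    rintro rfl
    exact h ((isSquare_apply_mul_self σ x).mul (isSquare_apply_div_self τ y))

theorem IsFamilyAlpha.not_isSquare (h : IsFamilyAlpha σ τ α) (hσ : Odd (orderOf σ)) :
    ¬ IsSquare α := by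
  rintro ⟨b, rfl⟩
  obtain ⟨x, hx, hxe⟩ := exists_apply_mul_self_eq_sq hσ (left_ne_zero_of_mul h.ne_zero)
  exact h.ne_mul x 1 hx one_ne_zero (by simp [hxe])

/-- The factor c / τ c is absorbed by y^(τ-1). Such a factor appears in α when η is normalised to
-1. -/
theorem IsFamilyAlpha.mul_apply_div (h : IsFamilyAlpha σ τ α) {c : L} (hc : c ≠ 0) :
    IsFamilyAlpha σ τ (α * (c / τ c)) where
  ne_zero := mul_ne_zero h.ne_zero (div_ne_zero hc (by simpa using hc))
  ne_mul x y hx hy e := by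
    refine h.ne_mul x (y * c) hx (mul_ne_zero hy hc) ?_
    have : τ c ≠ 0 := by simpa using hc
    rw [map_mul]
    field_simp at e ⊢
    exact e

/-- Exchanging the coordinates, with a twist, turns the Zhou–Pott multiplication into the
multiplication of the family with `η = -1`. -/
theorem isotopic_zhouPottMul_familyMul [Finite L] (σ τ : RingAut L) (α : L) :
    Isotopic (zhouPottMul σ τ α) (familyMul σ τ⁻¹ α (-1)) := by
  let N : L × L ≃+ L × L := (AddEquiv.prodCongr (AddEquiv.refl L) τ.toAddEquiv).trans
    AddEquiv.prodComm
  have hN (x : L × L) : N x = (τ x.2, x.1) := rfl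
  have e (x : L) : τ⁻¹ (τ x) = x := τ.symm_apply_apply x
  refine ⟨AddEquiv.refl _, N, N, fun x y => ?_⟩
  simp only [AddEquiv.refl_apply, zhouPottMul, familyMul, hN, e, map_neg, map_one, map_add, map_mul,
    ringAut_comm σ τ, Prod.mk.injEq]
  constructor <;> ring

/-- Scaling the second argument by an element `b` with `-η * b = σ b` brings `η` to `-1`. -/
theorem isotopic_familyMul_neg_one [Finite L] {b : L} (hb : b ≠ 0) (h : -η * b = σ b) :
    Isotopic (familyMul σ τ α η)
      (familyMul σ τ (α * (σ (τ⁻¹ b) / τ (σ (τ⁻¹ b)))) (-1)) := by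
  have hc : τ (σ (τ⁻¹ b)) = σ b := by
    rw [ringAut_comm τ σ]
    exact congrArg σ (τ.apply_symm_apply b)
  have hσb : σ b ≠ 0 := by simpa using hb
  have hτb : τ⁻¹ b ≠ 0 := by simpa using hb
  have hηb : τ⁻¹ η * τ⁻¹ b = -σ (τ⁻¹ b) := by
    rw [← map_mul, ringAut_comm σ τ⁻¹, ← h, ← map_neg]
    congr 1
    ring
  let scale (u v : Lˣ) : L × L ≃+ L × L := AddEquiv.prodCongr (AddAut.mulLeft u) (AddAut.mulLeft v)
  have hs (u v : Lˣ) (x : L × L) : scale u v x = (u * x.1, v * x.2) := rfl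
  -- Scaling y₁ by b gives both terms in x₁, y₁ the factor σ b. The second component then requires
  -- τ⁻¹ b on y₀, and the mismatch between σ(τ⁻¹ b) and σ b moves into α.
  refine Isotopic.symm ⟨scale (Units.mk0 _ hσb) (Units.mk0 b hb), AddEquiv.refl _,
    scale (Units.mk0 _ hτb) (Units.mk0 b hb), fun x y => ?_⟩
  have hb' : τ (τ⁻¹ b) = b := τ.apply_symm_apply b
  simp only [hs, AddEquiv.refl_apply, familyMul, map_mul, map_neg, map_one, hc, Units.val_mk0,
    Prod.mk.injEq, hb']
  constructor
  · field_simp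
    linear_combination -(σ x.2 * y.2) * h + α * σ x.1 * y.1 * hηb
  · ring

/-- Among the admissible parameters, those of the members of the family that are isotopic to a
Zhou–Pott semifield. -/
theorem isIsotopicToZhouPott_familyMul_iff {L : Type u} [Field L] [Finite L] {σ τ : RingAut L}
    {α η : L} (hσ : σ ^ 2 ≠ 1) (hτ : τ ≠ 1) (h : IsFamilyParam σ τ α η) :
    IsIsotopicToZhouPott (familyMul σ τ α η) ↔ Odd (orderOf σ) ∧ fixedNorm σ η = -1 := by
  constructor
  · rintro ⟨F, _, _, σ', τ', α', -, hiso⟩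
    obtain ⟨A, hA⟩ := hiso.exists_twist_comm (zhouPottMul_comm σ' τ' α')
    exact odd_and_fixedNorm_eq_neg_one hσ hτ h hA
  · rintro ⟨ho, hN⟩
    have h1 : fixedNorm σ (-η) = 1 := by
      rw [fixedNorm_neg, hN, ho.neg_one_pow, neg_one_mul, neg_neg]
    obtain ⟨b, hb, hbe⟩ := exists_mul_eq_of_fixedNorm_eq_one σ h1
    -- In characteristic two, N(η) = -1 would be the forbidden value 1.
    have hchar : ringChar L ≠ 2 := by
      refine ringChar_ne_two_iff.2 fun h2 => h.norm_ne_one ?_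
      rw [hN]
      exact Subtype.ext h2
    have hc : σ (τ⁻¹ b) ≠ 0 := by simpa using hb
    refine ⟨L, inferInstance, inferInstance, σ, τ⁻¹, _,
      ⟨hchar, ho, (h.alpha.mul_apply_div hc).not_isSquare ho⟩, ?_⟩
    have h2 := isotopic_zhouPottMul_familyMul σ τ⁻¹ (α * (σ (τ⁻¹ b) / τ (σ (τ⁻¹ b))))
    rw [inv_inv] at h2
    exact (isotopic_familyMul_neg_one hb hbe).trans h2.symm

/-- The fibres of the norm over the nonzero elements have the same number of elements. -/
theorem ncard_fixedNorm_eq [Finite L] (σ : RingAut L) {k l : fixedSubfield σ} (hk : k ≠ 0)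
    (hl : l ≠ 0) : {x | fixedNorm σ x = k}.ncard = {x | fixedNorm σ x = l}.ncard := by
  obtain ⟨c, hc⟩ := fixedNorm_surjective σ (l / k)
  have hc0 : c ≠ 0 := by
    rw [← fixedNorm_ne_zero σ, hc]
    exact div_ne_zero hl hk
  refine Set.ncard_congr (fun x _ => c * x) (fun x hx => ?_)
    (fun x y _ _ e => mul_left_cancel₀ hc0 e) fun y hy => ⟨c⁻¹ * y, ?_, mul_inv_cancel_left₀ hc0 y⟩
  · rw [Set.mem_ofPred_eq] at hx ⊢
    rw [fixedNorm_mul, hc, hx, div_mul_cancel₀ _ hk]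
  · rw [Set.mem_ofPred_eq] at hy ⊢
    apply mul_left_cancel₀ (div_ne_zero hl hk)
    rw [← hc, ← fixedNorm_mul, mul_inv_cancel_left₀ hc0, hy, hc, div_mul_cancel₀ _ hk]

/-- The set is the union of the equal-sized norm fibres over the |K| - 2 elements of K other than 0
and 1. -/
theorem ncard_fixedNorm_ne [Finite L] (σ : RingAut L) {k : fixedSubfield σ} (hk : k ≠ 0) :
    {x | x ≠ 0 ∧ fixedNorm σ x ≠ 1}.ncard =
      (Nat.card (fixedSubfield σ) - 2) * {x | fixedNorm σ x = k}.ncard := by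
  classical
  have : Fintype L := Fintype.ofFinite L
  have : Fintype (fixedSubfield σ) := Fintype.ofFinite _
  let t : Finset (fixedSubfield σ) := Finset.univ \ {0, 1}
  have ht {l} : l ∈ t ↔ l ≠ 0 ∧ l ≠ 1 := by simp [t]
  have htc : t.card = Nat.card (fixedSubfield σ) - 2 := by
    rw [Finset.card_sdiff_of_subset (Finset.subset_univ _), Finset.card_pair zero_ne_one,
      Finset.card_univ, Nat.card_eq_fintype_card]
  rw [Set.ncard_eq_toFinset_card', Finset.card_eq_sum_card_fiberwise (f := fixedNorm σ) (t := t),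
    ← htc, ← smul_eq_mul, ← Finset.sum_const]
  · refine Finset.sum_congr rfl fun l hl => ?_
    rw [ncard_fixedNorm_eq σ hk (ht.1 hl).1, Set.ncard_eq_toFinset_card']
    congr 1
    ext x
    simp only [Finset.mem_filter, Set.mem_toFinset, Set.mem_ofPred_eq]
    constructor
    · exact fun h => h.2
    · rintro rfl
      exact ⟨⟨(fixedNorm_ne_zero σ).1 (ht.1 hl).1, (ht.1 hl).2⟩, rfl⟩
  · intro x hx
    have hx : x ≠ 0 ∧ fixedNorm σ x ≠ 1 := by simpa using hx
    exact ht.2 ⟨(fixedNorm_ne_zero σ).2 hx.1, hx.2⟩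

theorem exists_ne_zero_one_neg_one {K : Type*} [Field K] (h : 3 < Nat.card K) :
    ∃ k : K, k ≠ 0 ∧ k ≠ 1 ∧ k ≠ -1 := by
  classical
  by_contra! hk
  have : Finite K := Nat.finite_of_card_ne_zero (by lia)
  have : Fintype K := Fintype.ofFinite K
  have hsub : (Finset.univ : Finset K) ⊆ {0, 1, -1} := fun k _ => by
    by_cases h0 : k = 0
    · simp [h0]
    by_cases h1 : k = 1
    · simp [h1]
    simp [hk k h0 h1]
  have := (Finset.card_le_card hsub).trans Finset.card_le_three
  rw [Finset.card_univ, ← Nat.card_eq_fintype_card] at this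
  lia

end Family

theorem mainTheorem5 {L : Type u} [Field L] [Finite L] (σ τ : RingAut L) :
    -- the family consists of (pre-)semifields
    (∀ α η : L, IsFamilyParam σ τ α η → IsPresemifield (familyMul σ τ α η)) ∧
    -- which members are isotopic to a Zhou–Pott semifield
    (σ ^ 2 ≠ 1 → τ ≠ 1 → ∀ α η : L, IsFamilyParam σ τ α η →
      (IsIsotopicToZhouPott (familyMul σ τ α η) ↔
        Odd (orderOf σ) ∧ fixedNorm σ η = -1)) ∧
    -- every Zhou–Pott semifield is, up to isotopy, a member of the family
    (∀ α : L, IsZhouPottParam σ α →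
      IsFamilyParam σ τ⁻¹ α (-1) ∧
        Isotopic (zhouPottMul σ τ α) (familyMul σ τ⁻¹ α (-1))) ∧
    -- the family contains members that are not isotopic to any Zhou–Pott semifield
    (σ ^ 2 ≠ 1 → τ ≠ 1 → ringChar L ≠ 2 →
      3 < Nat.card (fixedSubfield σ) ∨ Even (orderOf σ) →
      ∃ α η : L, η ≠ 0 ∧ IsFamilyParam σ τ α η ∧
        ¬ IsIsotopicToZhouPott (familyMul σ τ α η)) ∧
    -- exactly one in `|K| - 2` of the nonzero parameters `η` gives a Zhou–Pott semifield
    (σ ^ 2 ≠ 1 → τ ≠ 1 → ringChar L ≠ 2 → Odd (orderOf σ) →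
      ∀ α : L, IsFamilyAlpha σ τ α →
        {η : L | η ≠ 0 ∧ IsFamilyParam σ τ α η}.ncard =
          (Nat.card (fixedSubfield σ) - 2) *
            {η : L | η ≠ 0 ∧ IsFamilyParam σ τ α η ∧
              IsIsotopicToZhouPott (familyMul σ τ α η)}.ncard) := by
  refine ⟨fun α η h => isPresemifield_familyMul h,
    fun hσ hτ α η h => isIsotopicToZhouPott_familyMul_iff hσ hτ h, fun α h => ⟨⟨?_, ?_⟩, ?_⟩,
    fun hσ hτ hchar hK => ?_, fun hσ hτ hchar ho α hα => ?_⟩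
  · exact isFamilyAlpha_of_not_isSquare h.not_isSquare
  · rw [fixedNorm_neg_one, h.odd_order.neg_one_pow]
    exact fun e => ringChar_ne_two_iff.1 h.char_ne_two (congrArg Subtype.val e)
  · exact isotopic_zhouPottMul_familyMul σ τ α
  · obtain ⟨α, hα⟩ := FiniteField.exists_nonsquare hchar
    have hneg : (-1 : fixedSubfield σ) ≠ 1 := fun e =>
      ringChar_ne_two_iff.1 hchar (congrArg Subtype.val e)
    -- For even order k = -1 serves, since Zhou–Pott members need odd order; otherwise |K| > 3
    -- leaves a value besides 0, 1, -1.
    obtain ⟨k, hk0, hk1, hk⟩ : ∃ k : fixedSubfield σ, k ≠ 0 ∧ k ≠ 1 ∧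
        ¬ (Odd (orderOf σ) ∧ k = -1) := by
      rcases hK with hK | he
      · obtain ⟨k, hk0, hk1, hk⟩ := exists_ne_zero_one_neg_one hK
        exact ⟨k, hk0, hk1, fun h => hk h.2⟩
      · exact ⟨-1, neg_ne_zero.2 one_ne_zero, hneg, fun h => Nat.not_even_iff_odd.2 h.1 he⟩
    obtain ⟨η, rfl⟩ := fixedNorm_surjective σ k
    have hp : IsFamilyParam σ τ α η := ⟨isFamilyAlpha_of_not_isSquare hα, hk1⟩
    exact ⟨α, η, (fixedNorm_ne_zero σ).1 hk0, hp,
      fun h => hk ((isIsotopicToZhouPott_familyMul_iff hσ hτ hp).1 h)⟩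
  · have hneg : (-1 : fixedSubfield σ) ≠ 1 := fun e =>
      ringChar_ne_two_iff.1 hchar (congrArg Subtype.val e)
    have h0 : (-1 : fixedSubfield σ) ≠ 0 := neg_ne_zero.2 one_ne_zero
    -- The Zhou–Pott parameters are exactly the norm fibre over -1.
    convert ncard_fixedNorm_ne σ h0 using 3
    · ext η
      exact and_congr_right fun _ => ⟨fun h => h.norm_ne_one, fun h => ⟨hα, h⟩⟩
    · ext η
      constructor
      · rintro ⟨-, hp, hz⟩
        exact ((isIsotopicToZhouPott_familyMul_iff hσ hτ hp).1 hz).2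
      · intro (hN : fixedNorm σ η = -1)
        have hp : IsFamilyParam σ τ α η := ⟨hα, by rwa [hN]⟩
        exact ⟨(fixedNorm_ne_zero σ).1 (by rwa [hN]), hp,
          (isIsotopicToZhouPott_familyMul_iff hσ hτ hp).2 ⟨ho, hN⟩⟩
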